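/- Let $\Bbbk$ be an algebraically closed field of characteristic $0$, let $n\ge 0$, let $A=\Bbbk[x_1,\dots,x_n]$, let $\mathcal V=\mathrm{Der}_{\Bbbk}(A)$ be the Lie algebra of polynomial vector fields, and let $A\#U(\mathcal V)$ be the smash product, i.e. the space $A\otimes U(\mathcal V)$ with the product $(f\otimes u)(g\otimes v)=\sum f\,u^{(1)}(g)\otimes u^{(2)}v$, where $\Delta(u)=\sum u^{(1)}\otimes u^{(2)}$ is the usual coproduct of $U(\mathcal V)$. An $A\mathcal V$-module is a left module over $A\#U(\mathcal V)$; it is in particular a module over $A$ and over $\mathcal V$. For a finitely generated $\Bbbk$-algebra $R$ and a finitely generated $R$-module $M$, the Gelfand–Kirillov dimension is $\mathrm{GKdim}_R(M)=\limsup_{m\to\infty}\log_m\dim_{\Bbbk}(C^mM_0)$, where $C\ni 1$ is any finite-dimensional subspace generating the algebra $R$ and $M_0$ is any finite-dimensional subspace generating the $R$-module $M$ (the value does not depend on these choices). An $A\mathcal V$-module $M$ is called holonomic if it is finitely generated over $A\#U(\mathcal V)$ and either $M=0$ or $\mathrm{GKdim}_{A\#U(\mathcal V)}(M)=n$. A gauge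 module is an $A\mathcal V$-module $M$ with an isomorphism of $A$-modules $M\cong A\otimes W$, $\dim_{\Bbbk} W<\infty$, a Lie algebra homomorphism $\rho:\mathcal L_+\to \mathfrak{gl}_A(A\otimes W)$, where $\mathcal L_+$ is the Lie algebra of derivations of $\Bbbk[X_1,\dots,X_n]$ that vanish at the origin, and $A$-linear maps $B_i:A\otimes W\to A\otimes W$, $i=1,\dots,n$, such that $[\frac{\partial}{\partial x_i}\otimes 1+B_i,\frac{\partial}{\partial x_j}\otimes 1+B_j]=0$, $[B_i,\rho(\mathcal L_+)]=0$ and, for all multi-indices $m$ and all $i$, $g\in A$, $w\in W$, $$\Big(x^m\frac{\partial}{\partial x_i}\Big)(g\otimes w)=x^m\frac{\partial g}{\partial x_i}\otimes w+x^m g\,B_i(1\otimes w)+g\sum_{0<k\le m}\binom mk x^{m-k}\rho\Big(X^k\frac{\partial}{\partial X_i}\Big)(1\otimes w).$$ **Proposition.** Let $M$ be an $A\mathcal V$-module. (1) If $M$ is finitely generated as an $A$-module, then $M$ is a holonomic $A\mathcal V$-module. (2) In particular, if $M$ is a gauge module, then $M$ is finitely generated as an $A$-module and is a holonomic $A\mathcal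 V$-module. -/

import Mathlib

open scoped TensorProduct

noncomputable section

/-! ### The smash product `A # U(𝒱)`, where `𝒱 = Der(A)` -/

namespace AV

section Smash

attribute [local instance] LieRing.ofAssociativeRing

variable (k : Type*) [CommRing k] (A : Type*) [CommRing A] [Algebra k A]

/-- The universal enveloping algebra `U(𝒱)` of the Lie algebra `𝒱 = Der_k(A)`. -/
abbrev UV : Type _ := UniversalEnvelopingAlgebra k (Derivation k A A)

/-- The coproduct of `U(𝒱)`: the algebra homomorphism with `Δ η = η ⊗ 1 + 1 ⊗ η` for `η ∈ 𝒱`. -/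
def comul : UV k A →ₐ[k] UV k A ⊗[k] UV k A :=
  UniversalEnvelopingAlgebra.lift k
    { toFun := fun η =>
        UniversalEnvelopingAlgebra.ι k η ⊗ₜ[k] 1 + 1 ⊗ₜ[k] UniversalEnvelopingAlgebra.ι k η
      map_add' := fun x y => by
        simp only [map_add, TensorProduct.add_tmul, TensorProduct.tmul_add]; abel
      map_smul' := fun c x => by
        simp only [map_smul, TensorProduct.smul_tmul', TensorProduct.tmul_smul, smul_add,
          RingHom.id_apply]
      map_lie' := fun {x y} => by
        simp only [LieHom.map_lie, LieRing.of_associative_ring_bracket, mul_add, add_mul,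
          Algebra.TensorProduct.tmul_mul_tmul, mul_one, one_mul, TensorProduct.sub_tmul,
          TensorProduct.tmul_sub]
        abel }

/-- The action of `U(𝒱)` on `A` that extends the action of `𝒱` by derivations. -/
def act : UV k A →ₐ[k] Module.End k A :=
  UniversalEnvelopingAlgebra.lift k (LieModule.toEnd k (Derivation k A A) A)

/-- The underlying space `A ⊗ U(𝒱)` of the smash product (a type synonym, as the multiplication
is not the one of the tensor product of algebras). -/
def Smash : Type _ := A ⊗[k] UV k A

namespace Smash

instance : AddCommGroup (Smash k A) := inferInstanceAs (AddCommGroup (A ⊗[k] UV k A))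
instance : Module k (Smash k A) := inferInstanceAs (Module k (A ⊗[k] UV k A))
/-- `f • (g # u) = (f * g) # u`. -/
instance : Module A (Smash k A) := inferInstanceAs (Module A (A ⊗[k] UV k A))
instance : IsScalarTower k A (Smash k A) := inferInstanceAs (IsScalarTower k A (A ⊗[k] UV k A))
instance : SMulCommClass k A (Smash k A) := inferInstanceAs (SMulCommClass k A (A ⊗[k] UV k A))

variable {A}

/-- The element `f # u` of the smash product. -/
def mk (f : A) (u : UV k A) : Smash k A := f ⊗ₜ[k] u

variable (A)

/-- The diagonal action of `U(𝒱)` on `A ⊗ U(𝒱)`: if `Δ u = ∑ u₁ ⊗ u₂`, then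
`u • (g ⊗ v) = ∑ u₁(g) ⊗ u₂ v`. -/
def diag : UV k A →ₐ[k] Module.End k (Smash k A) :=
  (show (UV k A ⊗[k] UV k A) →ₐ[k] Module.End k (A ⊗[k] UV k A) from
    (Module.endTensorEndAlgHom (R := k) (S := k) (A := k) (M := A) (N := UV k A)).comp
      (Algebra.TensorProduct.map (act k A) (Algebra.lmul k (UV k A)))).comp (comul k A)

/-- Left multiplication in the smash product: `(f ⊗ u) x = f • (u • x)`. -/
def lmul : Smash k A →ₗ[k] Module.End k (Smash k A) :=
  show (A ⊗[k] UV k A) →ₗ[k] Module.End k (Smash k A) from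
    TensorProduct.lift
      ((LinearMap.mul k (Module.End k (Smash k A))).compl₁₂
        (Algebra.lsmul k k (Smash k A) : A →ₐ[k] Module.End k (Smash k A)).toLinearMap
        (diag k A).toLinearMap)

instance : Mul (Smash k A) := ⟨fun x y => lmul k A x y⟩
instance : One (Smash k A) := ⟨mk k 1 1⟩

variable {k A}

theorem induction {p : Smash k A → Prop} (x : Smash k A) (h0 : p 0)
    (h1 : ∀ f u, p (mk k f u)) (h2 : ∀ x y, p x → p y → p (x + y)) : p x :=
  TensorProduct.induction_on x h0 h1 h2

theorem lmul_mk (f : A) (u : UV k A) (x : Smash k A) :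
    lmul k A (mk k f u) x = f • diag k A u x := by
  rfl

theorem diag_ι (η : Derivation k A A) (g : A) (v : UV k A) :
    diag k A (UniversalEnvelopingAlgebra.ι k η) (mk k g v) =
      mk k (η g) v + mk k g (UniversalEnvelopingAlgebra.ι k η * v) := by
  change (Module.endTensorEndAlgHom (R := k) (S := k) (A := k) (M := A) (N := UV k A)
    (Algebra.TensorProduct.map (act k A) (Algebra.lmul k (UV k A))
      (comul k A (UniversalEnvelopingAlgebra.ι k η)))) (g ⊗ₜ[k] v) = _
  rw [comul, UniversalEnvelopingAlgebra.lift_ι_apply]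
  simp only [LieHom.coe_mk, map_add, Algebra.TensorProduct.map_tmul, map_one, LinearMap.add_apply,
    Module.endTensorEndAlgHom_apply, TensorProduct.AlgebraTensorModule.map_tmul]
  rw [act, UniversalEnvelopingAlgebra.lift_ι_apply]
  rfl

theorem smul_mk (f g : A) (v : UV k A) : f • mk k g v = mk k (f * g) v := rfl

/-- The multiplication of the smash product: `(f ⊗ u)(g ⊗ v) = ∑ f u₁(g) ⊗ u₂ v` whenever
`Δ u = ∑ u₁ ⊗ u₂`. -/
theorem mk_mul_mk {ι : Type*} (s : Finset ι) (f g : A) (u v : UV k A) (u₁ u₂ : ι → UV k A)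
    (hu : comul k A u = ∑ i ∈ s, u₁ i ⊗ₜ[k] u₂ i) :
    mk k f u * mk k g v = ∑ i ∈ s, mk k (f * act k A (u₁ i) g) (u₂ i * v) := by
  change lmul k A (mk k f u) (mk k g v) = _
  rw [lmul_mk]
  change f • (Module.endTensorEndAlgHom (R := k) (S := k) (A := k) (M := A) (N := UV k A)
    (Algebra.TensorProduct.map (act k A) (Algebra.lmul k (UV k A)) (comul k A u)))
      (g ⊗ₜ[k] v) = _
  rw [hu]
  simp only [map_sum, Algebra.TensorProduct.map_tmul, LinearMap.sum_apply,
    Module.endTensorEndAlgHom_apply, TensorProduct.AlgebraTensorModule.map_tmul, Finset.smul_sum]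
  rfl

theorem lmul_smul (f : A) (x : Smash k A) (y : Smash k A) :
    lmul k A (f • x) y = f • lmul k A x y := by
  induction x using induction with
  | h0 => simp
  | h1 g u => rw [smul_mk, lmul_mk, lmul_mk, mul_smul]
  | h2 a b ha hb => simp only [smul_add, map_add, LinearMap.add_apply, ha, hb]

theorem mk_eq_smul (f : A) (u : UV k A) : mk k f u = f • mk k 1 u := by
  rw [smul_mk, mul_one]

/-- Right multiplication by `v ∈ U(𝒱)` on `A ⊗ U(𝒱)`. -/
def rmul (v : UV k A) : Smash k A →ₗ[k] Smash k A :=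
  show (A ⊗[k] UV k A) →ₗ[k] (A ⊗[k] UV k A) from
    LinearMap.lTensor A (LinearMap.mulRight k v)

theorem rmul_mk (v : UV k A) (f : A) (u : UV k A) : rmul v (mk k f u) = mk k f (u * v) := rfl

/-- `U(𝒱)` is generated by `𝒱`. -/
theorem uv_induction {p : UV k A → Prop} (u : UV k A) (hc : ∀ c : k, p (algebraMap k _ c))
    (hι : ∀ η, p (UniversalEnvelopingAlgebra.ι k η)) (hm : ∀ a b, p a → p b → p (a * b))
    (ha : ∀ a b, p a → p b → p (a + b)) : p u := by
  let S : Subalgebra k (UV k A) :=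
    { carrier := {u | p u}
      mul_mem' := fun {a b} => hm a b
      add_mem' := fun {a b} => ha a b
      algebraMap_mem' := hc }
  let F : UV k A →ₐ[k] S := UniversalEnvelopingAlgebra.lift k
    { toFun := fun η => ⟨UniversalEnvelopingAlgebra.ι k η, hι η⟩
      map_add' := fun x y => Subtype.ext (by simp only [map_add]; rfl)
      map_smul' := fun c x => Subtype.ext (by simp only [map_smul]; rfl)
      map_lie' := fun {x y} => Subtype.ext (by
        simp only [LieHom.map_lie, LieRing.of_associative_ring_bracket]; rfl) }
  have h : S.val.comp F = AlgHom.id k _ := by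
    apply UniversalEnvelopingAlgebra.hom_ext
    ext η
    change ((UniversalEnvelopingAlgebra.lift k _ (UniversalEnvelopingAlgebra.ι k η) : S) :
      UV k A) = UniversalEnvelopingAlgebra.ι k η
    rw [UniversalEnvelopingAlgebra.lift_ι_apply]
    rfl
  have h2 : ((F u : S) : UV k A) = u := DFunLike.congr_fun h u
  rw [← h2]
  exact (F u).2

theorem diag_rmul (u v : UV k A) (x : Smash k A) :
    diag k A u (rmul v x) = rmul v (diag k A u x) := by
  induction u using uv_induction generalizing x with
  | hc c => simp only [AlgHom.commutes, Module.algebraMap_end_apply, map_smul]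
  | hι η =>
    induction x using induction with
    | h0 => simp
    | h1 g w => simp only [rmul_mk, diag_ι, map_add, mul_assoc]
    | h2 a b ha hb => simp only [map_add, ha, hb]
  | hm a b ha hb => simp only [map_mul, Module.End.mul_apply, ha, hb]
  | ha a b ha hb => simp only [map_add, LinearMap.add_apply, ha, hb]

theorem lmul_rmul (v : UV k A) (x y : Smash k A) :
    lmul k A (rmul v x) y = lmul k A x (diag k A v y) := by
  induction x using induction with
  | h0 => simp
  | h1 g w => simp only [rmul_mk, lmul_mk, map_mul, Module.End.mul_apply]
  | h2 a b ha hb => simp only [map_add, LinearMap.add_apply, ha, hb]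

theorem diag_smul_ι (η : Derivation k A A) (f : A) (x : Smash k A) :
    diag k A (UniversalEnvelopingAlgebra.ι k η) (f • x) =
      η f • x + f • diag k A (UniversalEnvelopingAlgebra.ι k η) x := by
  induction x using induction with
  | h0 => simp
  | h1 g w =>
    simp only [smul_mk, diag_ι, smul_add, Derivation.leibniz, smul_eq_mul]
    have : mk k (f * η g + g * η f) w = mk k (f * η g) w + mk k (g * η f) w :=
      TensorProduct.add_tmul _ _ _
    rw [this, mul_comm g]
    abel
  | h2 a b ha hb => simp only [smul_add, map_add, ha, hb]; abel

theorem diag_lmul (u : UV k A) (x y : Smash k A) :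
    diag k A u (lmul k A x y) = lmul k A (diag k A u x) y := by
  induction u using uv_induction generalizing x y with
  | hc c => simp only [AlgHom.commutes, Module.algebraMap_end_apply, map_smul,
      LinearMap.smul_apply]
  | hι η =>
    induction x using induction with
    | h0 => simp
    | h1 g w =>
      simp only [lmul_mk, diag_ι, map_add, LinearMap.add_apply, diag_smul_ι, map_mul,
        Module.End.mul_apply]
    | h2 a b ha hb => simp only [map_add, LinearMap.add_apply, ha, hb]
  | hm a b ha hb => simp only [map_mul, Module.End.mul_apply, ha, hb]
  | ha a b ha hb => simp only [map_add, LinearMap.add_apply, ha, hb]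

theorem lmul_lmul (x y z : Smash k A) :
    lmul k A (lmul k A x y) z = lmul k A x (lmul k A y z) := by
  induction x using induction with
  | h0 => simp
  | h1 f u => rw [lmul_mk, lmul_smul, lmul_mk, diag_lmul]
  | h2 a b ha hb => simp only [map_add, LinearMap.add_apply, ha, hb]

theorem lmul_one_left (x : Smash k A) : lmul k A (mk k 1 1) x = x := by
  rw [lmul_mk, map_one, one_smul, Module.End.one_apply]

theorem diag_one (u : UV k A) : diag k A u (mk k 1 1) = mk k 1 u := by
  induction u using uv_induction with
  | hc c =>
    simp only [AlgHom.commutes, Module.algebraMap_end_apply]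
    rw [Algebra.algebraMap_eq_smul_one]
    exact (TensorProduct.tmul_smul c (1 : A) (1 : UV k A)).symm
  | hι η =>
    rw [diag_ι, Derivation.map_one_eq_zero, mul_one]
    have : mk k (0 : A) (1 : UV k A) = 0 := TensorProduct.zero_tmul _ _
    rw [this, zero_add]
  | hm a b ha hb =>
    have : mk k (1 : A) b = rmul b (mk k 1 1) := by rw [rmul_mk, one_mul]
    rw [map_mul, Module.End.mul_apply, hb, this, diag_rmul, ha, rmul_mk]
  | ha a b ha hb =>
    rw [map_add, LinearMap.add_apply, ha, hb]
    exact (TensorProduct.tmul_add _ _ _).symm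

theorem lmul_one_right (x : Smash k A) : lmul k A x (mk k 1 1) = x := by
  induction x using induction with
  | h0 => simp
  | h1 f u => rw [lmul_mk, diag_one, smul_mk, mul_one]
  | h2 a b ha hb => simp only [map_add, LinearMap.add_apply, ha, hb]

/-- The smash product `A # U(𝒱)` as a ring. -/
instance : Ring (Smash k A) :=
  { (inferInstance : AddCommGroup (Smash k A)) with
    mul := (· * ·)
    one := 1
    mul_assoc := fun x y z => lmul_lmul x y z
    one_mul := lmul_one_left
    mul_one := lmul_one_right
    left_distrib := fun x y z => map_add (lmul k A x) y z
    right_distrib := fun x y z => by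
      change lmul k A (x + y) z = lmul k A x z + lmul k A y z
      rw [map_add, LinearMap.add_apply]
    zero_mul := fun x => by
      change lmul k A 0 x = 0
      rw [map_zero, LinearMap.zero_apply]
    mul_zero := fun x => map_zero (lmul k A x) }

instance : Algebra k (Smash k A) :=
  Algebra.ofModule
    (fun c x y => by
      change lmul k A (c • x) y = c • lmul k A x y
      rw [map_smul, LinearMap.smul_apply])
    (fun c x y => map_smul (lmul k A x) c y)

instance : IsScalarTower A (Smash k A) (Smash k A) :=
  ⟨fun f x y => lmul_smul f x y⟩

end Smash

/-- The vector field `η ∈ 𝒱` as the element `1 # η` of `A # U(𝒱)`. -/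
def vf {k : Type*} [CommRing k] {A : Type*} [CommRing A] [Algebra k A]
    (η : Derivation k A A) : Smash k A :=
  Smash.mk k 1 (UniversalEnvelopingAlgebra.ι k η)

end Smash

/-! ### Gelfand–Kirillov dimension -/

section GK

open Filter

variable (k : Type*) [Field k] (R : Type*) [Ring R] [Algebra k R]
  (M : Type*) [AddCommGroup M] [Module k M] [Module R M] [IsScalarTower k R M]

/-- `C` is a finite-dimensional subspace of `R` that contains `1` and generates the algebra `R`. -/
structure IsGeneratingSubspace (C : Submodule k R) : Prop where
  finiteDimensional : FiniteDimensional k C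
  one_mem : (1 : R) ∈ C
  adjoin_eq_top : Algebra.adjoin k (C : Set R) = ⊤

/-- `M₀` is a finite-dimensional subspace of `M` that generates `M` as an `R`-module. -/
structure IsGeneratingSubspaceOfModule (M₀ : Submodule k M) : Prop where
  finiteDimensional : FiniteDimensional k M₀
  span_eq_top : Submodule.span R (M₀ : Set M) = ⊤

variable {k R M} in
/-- `limsup_{m → ∞} log_m (dim (C ^ m M₀))`. -/
def growth (C : Submodule k R) (M₀ : Submodule k M) : EReal :=
  limsup (fun m : ℕ =>
    ((Real.logb m (Module.finrank k ((C ^ m • M₀ : Submodule k M))) : ℝ) : EReal)) atTop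

/-- `GKdim_R(M) = d`, for a finitely generated `k`-algebra `R` and a finitely generated
`R`-module `M`: the growth exponent of `dim (C ^ m M₀)` is `d`, for every choice of generating
subspaces `C` of `R` and `M₀` of `M`. (Both exist by finite generation, and the exponent does not
depend on them.) -/
structure HasGKDim (d : EReal) : Prop where
  finiteType : Algebra.FiniteType k R
  finite : Module.Finite R M
  growth_eq : ∀ (C : Submodule k R) (M₀ : Submodule k M), IsGeneratingSubspace k R C →
    IsGeneratingSubspaceOfModule k R M M₀ → growth C M₀ = d

end GK

/-! ### Affine space -/

section AffineSpace

open MvPolynomial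

attribute [local instance] LieRing.ofAssociativeRing

/-- The polynomial algebra `A = k[x₁, …, xₙ]`. -/
abbrev Poly (k : Type*) [Field k] (n : ℕ) : Type _ := MvPolynomial (Fin n) k

/-- The Lie algebra `𝒱 = Der(A)` of polynomial vector fields on affine `n`-space. -/
abbrev VectorField (k : Type*) [Field k] (n : ℕ) : Type _ :=
  Derivation k (Poly k n) (Poly k n)

/-- The algebra `A # U(𝒱)`, whose modules are the `A𝒱`-modules. -/
abbrev AVAlg (k : Type*) [Field k] (n : ℕ) : Type _ := Smash k (Poly k n)

variable (k : Type*) [Field k] (n : ℕ)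

/-- A finitely generated `A𝒱`-module `M` is holonomic if `M = 0` or `GKdim M = n`. -/
def IsHolonomic (M : Type*) [AddCommGroup M] [Module k M] [Module (AVAlg k n) M]
    [IsScalarTower k (AVAlg k n) M] : Prop :=
  Module.Finite (AVAlg k n) M ∧
    (Subsingleton M ∨ HasGKDim k (AVAlg k n) M ((n : ℝ) : EReal))

variable {n} in
/-- The vector field `f ∂/∂xᵢ`. -/
def coordField (f : Poly k n) (i : Fin n) : VectorField k n := f • pderiv i

variable {n} in
/-- The monomial `x ^ m` for a multi-index `m`. -/
def xpow (m : Fin n →₀ ℕ) : Poly k n := monomial m 1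

/-- The maximal ideal `𝔪 = (x₁, …, xₙ)`. -/
def maxIdeal : Ideal (Poly k n) := Ideal.span (Set.range X)

theorem apply_mem_maxIdeal {D : VectorField k n}
    (hD : D ∈ maxIdeal k n • (⊤ : Submodule (Poly k n) (VectorField k n))) (f : Poly k n) :
    D f ∈ maxIdeal k n := by
  induction hD using Submodule.smul_induction_on' with
  | smul r hr D _ => exact Ideal.mul_mem_right _ _ hr
  | add x _ y _ hx hy => exact Ideal.add_mem _ hx hy

/-- The Lie algebra `𝓛₊ = 𝔪 Der(k[X₁, …, Xₙ])` of the vector fields vanishing at the origin. -/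
def Lplus : LieSubalgebra k (VectorField k n) :=
  { ((maxIdeal k n • (⊤ : Submodule (Poly k n) (VectorField k n))).restrictScalars k) with
    lie_mem' := by
      intro D E hD hE
      change D ∈ maxIdeal k n • (⊤ : Submodule (Poly k n) (VectorField k n)) at hD
      change E ∈ maxIdeal k n • (⊤ : Submodule (Poly k n) (VectorField k n)) at hE
      change ⁅D, E⁆ ∈ maxIdeal k n • (⊤ : Submodule (Poly k n) (VectorField k n))
      have key : ∀ (f g : Poly k n) (D E : VectorField k n),
          ⁅f • D, g • E⁆ = (f * D g) • E - (g * E f) • D + (f * g) • ⁅D, E⁆ := by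
        intro f g D E
        refine Derivation.ext fun a => ?_
        simp only [Derivation.commutator_apply, Derivation.smul_apply, Derivation.add_apply,
          Derivation.sub_apply, smul_eq_mul, Derivation.leibniz]
        ring
      induction hD using Submodule.smul_induction_on' with
      | smul f hf D _ =>
        induction hE using Submodule.smul_induction_on' with
        | smul g hg E _ =>
          rw [key]
          refine Submodule.add_mem _ (Submodule.sub_mem _ ?_ ?_) ?_
          · exact Submodule.smul_mem_smul (Ideal.mul_mem_right _ _ hf) trivial
          · exact Submodule.smul_mem_smul (Ideal.mul_mem_right _ _ hg) trivial
          · exact Submodule.smul_mem_smul (Ideal.mul_mem_right _ _ hf) trivial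
        | add x _ y _ hx hy =>
          have h : ⁅f • D, x + y⁆ = ⁅f • D, x⁆ + ⁅f • D, y⁆ := by
            refine Derivation.ext fun a => ?_
            simp only [Derivation.commutator_apply, Derivation.add_apply, map_add]
            abel
          rw [h]
          exact Submodule.add_mem _ hx hy
      | add x _ y _ hx hy =>
        have h : ⁅x + y, E⁆ = ⁅x, E⁆ + ⁅y, E⁆ := by
          refine Derivation.ext fun a => ?_
          simp only [Derivation.commutator_apply, Derivation.add_apply, map_add]
          abel
        rw [h]
        exact Submodule.add_mem _ hx hy }

variable {n}

theorem xpow_mem_maxIdeal {m : Fin n →₀ ℕ} (hm : m ≠ 0) : xpow k m ∈ maxIdeal k n := by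
  obtain ⟨i, hi⟩ := Finsupp.ne_iff.mp hm
  have h : xpow k m = X i * monomial (m - Finsupp.single i 1) 1 := by
    rw [xpow, X, monomial_mul, one_mul, add_tsub_cancel_of_le]
    exact Finsupp.single_le_iff.mpr (Nat.one_le_iff_ne_zero.mpr hi)
  rw [h]
  exact Ideal.mul_mem_right _ _ (Ideal.subset_span ⟨i, rfl⟩)

theorem coordField_mem_Lplus {m : Fin n →₀ ℕ} (hm : m ≠ 0) (i : Fin n) :
    coordField k (xpow k m) i ∈ Lplus k n := by
  have h : coordField k (xpow k m) i ∈
      maxIdeal k n • (⊤ : Submodule (Poly k n) (VectorField k n)) :=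
    Submodule.smul_mem_smul (xpow_mem_maxIdeal k hm) Submodule.mem_top
  exact h

/-- The basis element `X ^ m ∂/∂Xᵢ` of `𝓛₊`, for a multi-index `m ≠ 0`. -/
def lplusBasis (m : Fin n →₀ ℕ) (hm : m ≠ 0) (i : Fin n) : Lplus k n :=
  ⟨coordField k (xpow k m) i, coordField_mem_Lplus k hm i⟩

/-- `binom(m, r) = ∏ⱼ binom(mⱼ, rⱼ)` for multi-indices. -/
def multiChoose (m r : Fin n →₀ ℕ) : ℕ := ∏ j, (m j).choose (r j)

/-- The operator `∂/∂xᵢ ⊗ 1 + Bᵢ` on `A ⊗ W`. -/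
def covDeriv (W : Type*) [AddCommGroup W] [Module k W]
    (Bi : Module.End (Poly k n) (Poly k n ⊗[k] W)) (i : Fin n) :
    Module.End k (Poly k n ⊗[k] W) :=
  (pderiv i).toLinearMap.rTensor W + Bi.restrictScalars k

/-- A realization of the `A𝒱`-module `M` as a gauge module `A ⊗ W` with fibre `W`. -/
structure GaugeStructure (W : Type*) [AddCommGroup W] [Module k W]
    (M : Type*) [AddCommGroup M] [Module (Poly k n) M] [Module (AVAlg k n) M] where
  /-- the trivialization `A ⊗ W ≅ M`, which is `A`-linear -/
  e : (Poly k n ⊗[k] W) ≃ₗ[Poly k n] M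
  /-- the representation of `𝓛₊` by `A`-linear maps -/
  ρ : Lplus k n →ₗ⁅k⁆ Module.End (Poly k n) (Poly k n ⊗[k] W)
  /-- the gauge fields `Bᵢ` -/
  B : Fin n → Module.End (Poly k n) (Poly k n ⊗[k] W)
  /-- `[∂/∂xᵢ ⊗ 1 + Bᵢ, ∂/∂xⱼ ⊗ 1 + Bⱼ] = 0` -/
  flat : ∀ i j : Fin n,
    Commute (covDeriv k W (B i) i) (covDeriv k W (B j) j)
  /-- `[Bᵢ, ρ(𝓛₊)] = 0` -/
  B_comm_ρ : ∀ (i : Fin n) (l : Lplus k n), Commute (B i) (ρ l)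
  /-- `(x ^ m ∂/∂xᵢ)(g ⊗ w) = x ^ m ∂g/∂xᵢ ⊗ w + x ^ m g Bᵢ(w)
  + g ∑_{0 < r ≤ m} binom(m, r) x ^ (m - r) ρ(X ^ r ∂/∂Xᵢ) w` -/
  vf_smul : ∀ (m : Fin n →₀ ℕ) (i : Fin n) (g : Poly k n) (w : W),
    vf (coordField k (xpow k m) i) • e (g ⊗ₜ[k] w) =
      e ((xpow k m * pderiv i g) ⊗ₜ[k] w + (xpow k m * g) • B i (1 ⊗ₜ[k] w) +
        g • ∑ r ∈ (Finset.Ioc 0 m).attach, (multiChoose m r.1 : k) • xpow k (m - r.1) •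
          ρ (lplusBasis k r.1 (Finset.mem_Ioc.mp r.2).1.ne' i) (1 ⊗ₜ[k] w))

variable (n) in
/-- `M` is a gauge module: it has a gauge structure with a finite-dimensional fibre `W`. (Every
such `W` is isomorphic to some `kʳ`, so that the universe of `W` does not matter.) -/
def IsGaugeModule (M : Type*) [AddCommGroup M] [Module (Poly k n) M]
    [Module (AVAlg k n) M] : Prop :=
  ∃ r : ℕ, Nonempty (GaugeStructure (n := n) k (Fin r → k) M)

end AffineSpace

end AV

end

/-! Suppose `M ≠ 0` is finitely generated over `A`; the growth of `C ^ m M₀` is squeezed between two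
multiples of `m ^ n`.

Upper bound: fix generators `eⱼ` and filter `M` by the sums `∑ pⱼ eⱼ` whose coefficients have degree
at most `d` in each variable. This piece has dimension at most `r (d + 1) ^ n`. Multiplication by a
polynomial and, by the Leibniz rule, action of a vector field raise `d` by a bounded amount; these
generate `A # U(𝒱)`, so `C ^ m M₀` lies in a piece whose index is linear in `m`
(`exists_pow_smul_le_boxFiltration`).

Lower bound: the annihilator of `M` in `A` is stable under all `∂ᵢ`, and in characteristic `0` a
proper ideal with this property is zero (`eq_top_of_pderiv_mem`). As `A` is a domain and `M` is
finitely generated, some `v` has zero annihilator (`exists_smul_injective`). Then `f ↦ f v` embeds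
boxes of polynomials, of side growing linearly in `m`, into `C ^ m M₀` (`restrictDegree_smul_mem`).

The definition of dimension also asks that `A # U(𝒱)` be a finitely generated algebra
(`AVAlg.finiteType`); brackets of monomial fields give this. A gauge module is free of finite rank
over `A`, so it is a special case. -/

noncomputable section

namespace AV

/-! ### Commutation relations and generators of the smash product. -/

section Smash
attribute [local instance] LieRing.ofAssociativeRing

variable {k : Type*} [CommRing k] {A : Type*} [CommRing A] [Algebra k A]

theorem Smash.mul_def (x y : Smash k A) : x * y = Smash.lmul k A x y := rfl

/-- `1 # v` is the right translate of the unit by `v`, and the diagonal action commutes with right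
multiplication. -/
theorem Smash.mk_one_mul_mk_one (u v : UV k A) :
    Smash.mk k (1 : A) u * Smash.mk k 1 v = Smash.mk k 1 (u * v) := by
  have h : Smash.mk k (1 : A) v = Smash.rmul v (Smash.mk k 1 1) := by rw [Smash.rmul_mk, one_mul]
  rw [Smash.mul_def, Smash.lmul_mk, one_smul, h, Smash.diag_rmul, Smash.diag_one, Smash.rmul_mk]

theorem Smash.mk_one_add (u v : UV k A) :
    Smash.mk k (1 : A) (u + v) = Smash.mk k 1 u + Smash.mk k 1 v :=
  TensorProduct.tmul_add _ _ _

theorem Smash.mk_one_smul (c : k) (u : UV k A) :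
    Smash.mk k (1 : A) (c • u) = c • Smash.mk k 1 u :=
  TensorProduct.tmul_smul _ _ _

theorem Smash.smul_one_mul (f : A) (x : Smash k A) : (f • (1 : Smash k A)) * x = f • x := by
  rw [smul_mul_assoc, one_mul]

/-- The relation `[η, f] = η(f)`, which holds because `η` is primitive for the coproduct; it is the
source of every Leibniz rule below. -/
theorem vf_mul_smul (η : Derivation k A A) (f : A) (x : Smash k A) :
    vf η * (f • x) = η f • x + f • (vf η * x) := by
  simp only [vf, Smash.mul_def, Smash.lmul_mk, one_smul, Smash.diag_smul_ι]

theorem vf_add (η μ : Derivation k A A) : vf (η + μ) = vf η + vf μ := by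
  rw [vf, map_add, Smash.mk_one_add]; rfl

theorem vf_smul (c : k) (η : Derivation k A A) : vf (c • η) = c • vf η := by
  rw [vf, map_smul, Smash.mk_one_smul]; rfl

theorem vf_lie (η μ : Derivation k A A) : vf ⁅η, μ⁆ = vf η * vf μ - vf μ * vf η := by
  rw [eq_sub_iff_add_eq, vf, vf, vf, Smash.mk_one_mul_mk_one, Smash.mk_one_mul_mk_one,
    ← Smash.mk_one_add, LieHom.map_lie]
  congr 1
  exact sub_add_cancel _ _

/-- `A # U(𝒱)` is generated by `A` and `𝒱`. -/
theorem Smash.subalgebra_eq_top (S : Subalgebra k (Smash k A))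
    (hA : ∀ f : A, f • (1 : Smash k A) ∈ S) (hV : ∀ η : Derivation k A A, vf η ∈ S) : S = ⊤ := by
  rw [eq_top_iff]
  rintro x -
  induction x using Smash.induction with
  | h0 => exact S.zero_mem
  | h1 f u =>
    have hu : Smash.mk k (1 : A) u ∈ S := by
      induction u using Smash.uv_induction with
      | hc c =>
        rw [Algebra.algebraMap_eq_smul_one, Smash.mk_one_smul]
        exact S.smul_mem S.one_mem c
      | hι η => exact hV η
      | hm a b ha hb => rw [← Smash.mk_one_mul_mk_one]; exact S.mul_mem ha hb
      | ha a b ha hb => rw [Smash.mk_one_add]; exact S.add_mem ha hb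
    rw [Smash.mk_eq_smul, ← Smash.smul_one_mul]
    exact S.mul_mem (hA f) hu
  | h2 a b ha hb => exact S.add_mem ha hb

end Smash

/-! ### Finite generation of `A # U(𝒱)`. -/

section Generators
open MvPolynomial

variable {k : Type*} [Field k] {n : ℕ}

theorem coordField_lie (f g : Poly k n) (i : Fin n) :
    ⁅coordField k f i, coordField k g i⁆ = coordField k (f * pderiv i g - g * pderiv i f) i := by
  refine Derivation.ext fun a => ?_
  simp only [coordField, Derivation.commutator_apply, Derivation.smul_apply, smul_eq_mul,
    Derivation.leibniz]
  ring

/-- Stating the exponent through `h` avoids the truncated difference `a + b - single i 1`. -/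
theorem coordField_xpow_lie (a b c : Fin n →₀ ℕ) (i : Fin n)
    (h : a + b = c + Finsupp.single i 1) :
    ⁅coordField k (xpow k a) i, coordField k (xpow k b) i⁆ =
      ((b i : k) - (a i : k)) • coordField k (xpow k c) i := by
  have key : ∀ a b : Fin n →₀ ℕ, a + b = c + Finsupp.single i 1 →
      xpow k a * pderiv i (xpow k b) = (b i : k) • xpow k c := by
    intro a b h
    rw [xpow, xpow, xpow, pderiv_monomial, monomial_mul, smul_monomial]
    -- If `b i = 0`, truncated subtraction gives a wrong exponent, but both coefficients vanish.
    rcases Nat.eq_zero_or_pos (b i) with h0 | h0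
    · simp [h0]
    · congr 1
      · have hle : Finsupp.single i 1 ≤ b := Finsupp.single_le_iff.mpr h0
        have : a + (b - Finsupp.single i 1) + Finsupp.single i 1 = c + Finsupp.single i 1 := by
          rw [add_assoc, tsub_add_cancel_of_le hle, h]
        rw [add_right_cancel this]
      · simp
  rw [coordField_lie, key a b h, key b a (by rw [add_comm, h]), ← sub_smul, coordField, coordField,
    smul_assoc]

theorem vectorField_eq_sum (η : VectorField k n) : η = ∑ i, coordField k (η (X i)) i := by
  refine MvPolynomial.derivation_ext fun j => ?_
  have h : (∑ i, coordField k (η (X i)) i) (X j) = ∑ i, coordField k (η (X i)) i (X j) :=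
    (congrFun (map_sum (Derivation.coeFnAddMonoidHom (R := k) (A := Poly k n) (M := Poly k n)) _ _)
      _).trans (Finset.sum_apply _ _ _)
  rw [h]
  simp [coordField, pderiv_X, Pi.single_apply]

theorem smul_one_mem (S : Subalgebra k (AVAlg k n))
    (h : ∀ i : Fin n, (X i : Poly k n) • (1 : AVAlg k n) ∈ S) (f : Poly k n) :
    f • (1 : AVAlg k n) ∈ S := by
  induction f using MvPolynomial.induction_on with
  | C c =>
    rw [← mul_one (C c), ← MvPolynomial.smul_eq_C_mul, smul_assoc, one_smul]
    exact S.smul_mem S.one_mem c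
  | add p q hp hq => rw [add_smul]; exact S.add_mem hp hq
  | mul_X p i hp =>
    rw [mul_smul, ← Smash.smul_one_mul p]
    exact S.mul_mem hp (h i)

theorem vf_mem_of_xpow (S : Subalgebra k (AVAlg k n))
    (h : ∀ m i, vf (coordField k (xpow k m) i) ∈ S) (η : VectorField k n) : vf η ∈ S := by
  let V : Submodule k (VectorField k n) :=
    { carrier := {η | vf η ∈ S}
      add_mem' := fun {a b} ha hb => by
        rw [Set.mem_ofPred_eq, vf_add]; exact S.add_mem ha hb
      zero_mem' := by
        rw [Set.mem_ofPred_eq, ← zero_smul k (0 : VectorField k n), vf_smul, zero_smul]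
        exact S.zero_mem
      smul_mem' := fun c x hx => by
        rw [Set.mem_ofPred_eq, vf_smul]; exact S.smul_mem hx c }
  change η ∈ V
  rw [vectorField_eq_sum η]
  refine V.sum_mem fun i _ => ?_
  induction η (X i) using MvPolynomial.induction_on' with
  | monomial m c =>
    have : coordField k (monomial m c) i = c • coordField k (xpow k m) i := by
      rw [coordField, coordField, xpow, ← smul_assoc, smul_monomial, smul_eq_mul, mul_one]
    rw [this]
    exact V.smul_mem c (h m i)
  | add p q hp hq =>
    rw [coordField, add_smul]
    exact V.add_mem hp hq

variable [CharZero k]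

/-- A subalgebra that contains `∂ᵢ`, `xᵢ² ∂ᵢ`, `xᵢ³ ∂ᵢ` and `xᵢ xⱼ ∂ᵢ` contains all monomial
vector fields. -/
theorem vf_xpow_mem (S : Subalgebra k (AVAlg k n))
    (h0 : ∀ i, vf (coordField k (xpow k 0) i) ∈ S)
    (h3 : ∀ i : Fin n, vf (coordField k (xpow k (Finsupp.single i 3)) i) ∈ S)
    (h11 : ∀ i j : Fin n,
      vf (coordField k (xpow k (Finsupp.single i 1 + Finsupp.single j 1)) i) ∈ S)
    (m : Fin n →₀ ℕ) (i : Fin n) : vf (coordField k (xpow k m) i) ∈ S := by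
  -- In characteristic `0` the bracket can be divided by `b i - a i`. The induction on degree writes
  -- `m` as such a `c`, with `a` the exponent of a generator and `b` of smaller degree.
  have step : ∀ a b c : Fin n →₀ ℕ, a + b = c + Finsupp.single i 1 → b i ≠ a i →
      vf (coordField k (xpow k a) i) ∈ S → vf (coordField k (xpow k b) i) ∈ S →
      vf (coordField k (xpow k c) i) ∈ S := by
    intro a b c h hne ha hb
    have hc : ((b i : k) - (a i : k)) ≠ 0 := sub_ne_zero.mpr (by exact_mod_cast hne)
    have h2 := vf_lie (coordField k (xpow k a) i) (coordField k (xpow k b) i)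
    rw [coordField_xpow_lie a b c i h, vf_smul] at h2
    rw [← inv_smul_smul₀ hc (vf (coordField k (xpow k c) i)), h2]
    exact S.smul_mem (S.sub_mem (S.mul_mem ha hb) (S.mul_mem hb ha)) _
  induction hd : m.degree using Nat.strong_induction_on generalizing m with
  | _ d ih =>
    subst hd
    by_cases hm : m = 0
    · exact hm ▸ h0 i
    -- Bracket with `xᵢ xⱼ ∂ᵢ` for some `j ≠ i` occurring in `m`: here `a i = 1` and `b i = 0`.
    by_cases hi : m i = 0
    · obtain ⟨j, hj⟩ := Finsupp.ne_iff.mp hm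
      have hle : Finsupp.single j 1 ≤ m :=
        Finsupp.single_le_iff.mpr (Nat.one_le_iff_ne_zero.mpr hj)
      have hji : j ≠ i := fun h => hj (by rw [h, hi]; rfl)
      obtain ⟨b, rfl⟩ := exists_add_of_le hle
      refine step _ b _ (by abel) ?_ (h11 i j) (ih _ (by simp) b rfl)
      simp only [Finsupp.coe_add, Pi.add_apply, Finsupp.single_apply, hji, if_false, if_true] at hi ⊢
      omega
    -- Bracketing with `xᵢ² ∂ᵢ` fails exactly when `b i = m i - 1 = 2`. In that case `xᵢ³ ∂ᵢ` is
    -- used instead, with `b i = 1`.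
    by_cases hi3 : m i = 3
    · obtain ⟨b, rfl⟩ := exists_add_of_le (Finsupp.single_le_iff.mpr (by omega : 2 ≤ m i))
      refine step _ b _ ?_ ?_ (h3 i) (ih _ (by simp) b rfl)
      · rw [show (3 : ℕ) = 2 + 1 from rfl, Finsupp.single_add]; abel
      · simp only [Finsupp.coe_add, Pi.add_apply, Finsupp.single_eq_same] at hi3 ⊢
        omega
    · obtain ⟨b, rfl⟩ := exists_add_of_le
        (Finsupp.single_le_iff.mpr (Nat.one_le_iff_ne_zero.mpr hi))
      refine step _ b _ (by abel) ?_ (h11 i i) (ih _ (by simp) b rfl)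
      simp only [Finsupp.coe_add, Pi.add_apply, Finsupp.single_eq_same] at hi3 ⊢
      omega

instance AVAlg.finiteType : Algebra.FiniteType k (AVAlg k n) := by
  let s : Set (AVAlg k n) :=
    Set.range (fun i : Fin n => (X i : Poly k n) • (1 : AVAlg k n)) ∪
    (Set.range (fun i : Fin n => (vf (coordField k (xpow k 0) i) : AVAlg k n)) ∪
    (Set.range (fun i : Fin n =>
      (vf (coordField k (xpow k (Finsupp.single i 3)) i) : AVAlg k n)) ∪
    Set.range (fun p : Fin n × Fin n =>
      (vf (coordField k (xpow k (Finsupp.single p.1 1 + Finsupp.single p.2 1)) p.1) :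
        AVAlg k n))))
  have hs : s.Finite := (Set.finite_range _).union
    ((Set.finite_range _).union ((Set.finite_range _).union (Set.finite_range _)))
  refine ⟨Subalgebra.fg_def.mpr ⟨s, hs, ?_⟩⟩
  refine Smash.subalgebra_eq_top _ (smul_one_mem _ fun i => Algebra.subset_adjoin (.inl ⟨i, rfl⟩))
    (vf_mem_of_xpow _ (vf_xpow_mem _ (fun i => Algebra.subset_adjoin (.inr (.inl ⟨i, rfl⟩)))
      (fun i => Algebra.subset_adjoin (.inr (.inr (.inl ⟨i, rfl⟩))))
      (fun i j => Algebra.subset_adjoin (.inr (.inr (.inr ⟨(i, j), rfl⟩))))))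

end Generators

/-! ### Polynomials of bounded degree in each variable, and differential ideals. -/

section BoxDegree
open MvPolynomial
variable {k : Type*} [Field k] {n : ℕ}

theorem mem_restrictDegree_iff_degreeOf {p : Poly k n} {d : ℕ} :
    p ∈ restrictDegree (Fin n) k d ↔ ∀ i, p.degreeOf i ≤ d := by
  simp only [mem_restrictDegree, degreeOf_le_iff]
  exact ⟨fun h i m hm => h m hm i, fun h m hm i => h i m hm⟩

theorem restrictDegree_mono {c d : ℕ} (h : c ≤ d) :
    restrictDegree (Fin n) k c ≤ restrictDegree (Fin n) k d := fun _ hp =>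
  mem_restrictDegree_iff_degreeOf.mpr fun i => (mem_restrictDegree_iff_degreeOf.mp hp i).trans h

theorem mul_mem_restrictDegree {p q : Poly k n} {c d : ℕ} (hp : p ∈ restrictDegree (Fin n) k c)
    (hq : q ∈ restrictDegree (Fin n) k d) : p * q ∈ restrictDegree (Fin n) k (c + d) :=
  mem_restrictDegree_iff_degreeOf.mpr fun i => (degreeOf_mul_le i p q).trans
    (add_le_add (mem_restrictDegree_iff_degreeOf.mp hp i)
      (mem_restrictDegree_iff_degreeOf.mp hq i))

theorem mem_restrictDegree_totalDegree (p : Poly k n) :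
    p ∈ restrictDegree (Fin n) k p.totalDegree :=
  mem_restrictDegree_iff_degreeOf.mpr fun i => degreeOf_le_totalDegree p i

theorem add_single_mem_support_of_pderiv {p : Poly k n} {i : Fin n} {m : Fin n →₀ ℕ}
    (hm : m ∈ (pderiv i p).support) : m + Finsupp.single i 1 ∈ p.support := by
  rw [mem_support_iff, coeff_pderiv] at hm
  exact mem_support_iff.mpr (left_ne_zero_of_mul hm)

theorem pderiv_mem_restrictDegree {p : Poly k n} {d : ℕ} (hp : p ∈ restrictDegree (Fin n) k d)
    (i : Fin n) : pderiv i p ∈ restrictDegree (Fin n) k d := by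
  rw [mem_restrictDegree] at hp ⊢
  intro m hm j
  exact (Nat.le_add_right _ _).trans (hp _ (add_single_mem_support_of_pderiv hm) j)

theorem vectorField_apply (η : VectorField k n) (p : Poly k n) :
    η p = ∑ i, η (X i) * pderiv i p := by
  conv_lhs => rw [vectorField_eq_sum η]
  exact (congrFun (map_sum (Derivation.coeFnAddMonoidHom (R := k) (A := Poly k n)
    (M := Poly k n)) _ _) _).trans (Finset.sum_apply _ _ _)

/-- In `η p = ∑ η(xᵢ) ∂ᵢ p` only the factors `η(xᵢ)` can raise degrees, so the shift does not depend
on `p` or `d`. -/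
theorem exists_vectorField_mem_restrictDegree (η : VectorField k n) :
    ∃ D, ∀ d, ∀ p ∈ restrictDegree (Fin n) k d, η p ∈ restrictDegree (Fin n) k (d + D) := by
  refine ⟨Finset.univ.sup fun i => (η (X i)).totalDegree, fun d p hp => ?_⟩
  rw [vectorField_apply, add_comm]
  refine Submodule.sum_mem _ fun i hi => mul_mem_restrictDegree ?_ (pderiv_mem_restrictDegree hp i)
  exact restrictDegree_mono (Finset.le_sup (f := fun i => (η (X i)).totalDegree) hi)
    (mem_restrictDegree_totalDegree _)

theorem card_box (n d : ℕ) : Nat.card {m : Fin n →₀ ℕ | ∀ i, m i ≤ d} = (d + 1) ^ n := by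
  let e : {m : Fin n →₀ ℕ | ∀ i, m i ≤ d} ≃ (Fin n → Fin (d + 1)) :=
    { toFun := fun m i => ⟨m.1 i, Nat.lt_succ_of_le (m.2 i)⟩
      invFun := fun a => ⟨Finsupp.equivFunOnFinite.symm fun i => (a i : ℕ),
        fun i => Nat.le_of_lt_succ (a i).2⟩
      left_inv := fun m => Subtype.ext (Finsupp.ext fun i => rfl)
      right_inv := fun a => rfl }
  rw [Nat.card_congr e]
  simp

theorem finrank_restrictDegree (d : ℕ) :
    Module.finrank k (restrictDegree (Fin n) k d) = (d + 1) ^ n := by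
  rw [← card_box n d]
  exact Module.finrank_eq_nat_card_basis
    (basisRestrictSupport k {m : Fin n →₀ ℕ | ∀ i, m i ≤ d})

instance finiteDimensional_restrictDegree (d : ℕ) :
    FiniteDimensional k (restrictDegree (Fin n) k d) := by
  refine Module.finite_of_finrank_pos ?_
  rw [finrank_restrictDegree]
  positivity

/-- In characteristic `0` the polynomial ring has no nontrivial differential ideals. -/
theorem eq_top_of_pderiv_mem [CharZero k] {I : Ideal (Poly k n)}
    (hI : ∀ p ∈ I, ∀ i, pderiv i p ∈ I) (hne : I ≠ ⊥) : I = ⊤ := by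
  -- Differentiate a nonzero element until it becomes a nonzero constant, that is, a unit.
  have key : ∀ N : ℕ, ∀ p ∈ I, p ≠ 0 → (∀ m ∈ p.support, m.degree ≤ N) → I = ⊤ := by
    intro N
    induction N with
    | zero =>
      intro p hp h0 hd
      have hc : p = C (coeff 0 p) := by
        ext m
        rw [coeff_C]
        split_ifs with h
        · rw [h]
        · by_contra hm
          have := hd m (mem_support_iff.mpr hm)
          exact h ((Finsupp.degree_eq_zero_iff m).mp (Nat.le_zero.mp this)).symm
      have hc0 : coeff 0 p ≠ 0 := fun h => h0 (by rw [hc, h, C_0])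
      exact Ideal.eq_top_of_isUnit_mem I (hc ▸ hp) ((isUnit_iff_ne_zero.mpr hc0).map C)
    | succ N ih =>
      intro p hp h0 hd
      by_cases hN : ∀ m ∈ p.support, m.degree ≤ N
      · exact ih p hp h0 hN
      · push Not at hN
        obtain ⟨m, hm, hlt⟩ := hN
        have hm0 : m ≠ 0 := by rintro rfl; simp at hlt
        obtain ⟨i, hi⟩ := Finsupp.ne_iff.mp hm0
        obtain ⟨b, rfl⟩ := exists_add_of_le
          (Finsupp.single_le_iff.mpr (Nat.one_le_iff_ne_zero.mpr hi))
        -- The coefficient of `∂ᵢ p` at `b` is `b i + 1` times a nonzero coefficient of `p`, hence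
        -- nonzero in characteristic `0`.
        refine ih (pderiv i p) (hI p hp i) (fun h => ?_) fun m' hm' => ?_
        · have h2 := coeff_pderiv (i := i) p b
          rw [h, coeff_zero, add_comm b] at h2
          exact mul_ne_zero (mem_support_iff.mp hm) (Nat.cast_add_one_ne_zero _) h2.symm
        · have := hd _ (add_single_mem_support_of_pderiv hm')
          simpa using this
  obtain ⟨p, hp, h0⟩ := Submodule.exists_mem_ne_zero_of_ne_bot hne
  exact key p.totalDegree p hp h0 fun m hm => le_totalDegree hm

end BoxDegree

/-! ### The filtration of a finitely generated `A`-module by boxes. -/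

section BoxFiltration
open MvPolynomial
variable {k : Type*} [Field k] {n : ℕ} {M : Type*} [AddCommGroup M] [Module k M]
  [Module (Poly k n) M]

/-- The elements `∑ⱼ pⱼ eⱼ` of `M` in which every variable has degree at most `d` in every `pⱼ`. -/
def boxFiltration {r : ℕ} (e : Fin r → M) [IsScalarTower k (Poly k n) M] (d : ℕ) :
    Submodule k M :=
  LinearMap.range (((Fintype.linearCombination (Poly k n) e).restrictScalars k).comp
    (LinearMap.pi fun j => (restrictDegree (Fin n) k d).subtype.comp (LinearMap.proj j)))

variable [IsScalarTower k (Poly k n) M] {r : ℕ} {e : Fin r → M}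

theorem mem_boxFiltration {d : ℕ} {x : M} : x ∈ boxFiltration (k := k) (n := n) e d ↔
    ∃ p : Fin r → Poly k n, (∀ j, p j ∈ restrictDegree (Fin n) k d) ∧ x = ∑ j, p j • e j := by
  constructor
  · rintro ⟨p, rfl⟩
    exact ⟨fun j => (p j).1, fun j => (p j).2, rfl⟩
  · rintro ⟨p, hp, rfl⟩
    exact ⟨fun j => ⟨p j, hp j⟩, rfl⟩

instance finiteDimensional_boxFiltration (d : ℕ) :
    FiniteDimensional k (boxFiltration (k := k) (n := n) e d) := by
  unfold boxFiltration; infer_instance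

theorem finrank_boxFiltration_le (d : ℕ) :
    Module.finrank k (boxFiltration (k := k) (n := n) e d) ≤ r * (d + 1) ^ n := by
  refine (LinearMap.finrank_range_le _).trans ?_
  rw [Module.finrank_pi_fintype]
  simp [finrank_restrictDegree]

theorem boxFiltration_mono {c d : ℕ} (h : c ≤ d) :
    boxFiltration (k := k) (n := n) e c ≤ boxFiltration (k := k) (n := n) e d := by
  intro x hx
  obtain ⟨p, hp, rfl⟩ := mem_boxFiltration.mp hx
  exact mem_boxFiltration.mpr ⟨p, fun j => restrictDegree_mono h (hp j), rfl⟩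

theorem smul_mem_boxFiltration {c d : ℕ} {f : Poly k n} (hf : f ∈ restrictDegree (Fin n) k c)
    {x : M} (hx : x ∈ boxFiltration (k := k) (n := n) e d) :
    f • x ∈ boxFiltration (k := k) (n := n) e (c + d) := by
  obtain ⟨p, hp, rfl⟩ := mem_boxFiltration.mp hx
  refine mem_boxFiltration.mpr ⟨fun j => f * p j, fun j => mul_mem_restrictDegree hf (hp j), ?_⟩
  simp only [Finset.smul_sum, mul_smul]

theorem exists_mem_boxFiltration
    (he : Submodule.span (Poly k n) (Set.range e) = ⊤) (x : M) : ∃ d, x ∈ boxFiltration (k := k) (n := n) e d := by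
  have hx : x ∈ Submodule.span (Poly k n) (Set.range e) := he ▸ Submodule.mem_top
  obtain ⟨p, rfl⟩ := (Submodule.mem_span_range_iff_exists_fun _).mp hx
  exact ⟨Finset.univ.sup fun j => (p j).totalDegree, mem_boxFiltration.mpr ⟨p, fun j =>
    restrictDegree_mono (Finset.le_sup (f := fun j => (p j).totalDegree) (Finset.mem_univ j))
      (mem_restrictDegree_totalDegree _), rfl⟩⟩

theorem exists_le_boxFiltration
    (he : Submodule.span (Poly k n) (Set.range e) = ⊤) {N : Submodule k M} (hN : FiniteDimensional k N) :
    ∃ d, N ≤ boxFiltration (k := k) (n := n) e d := by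
  obtain ⟨s, rfl⟩ := (Module.Finite.iff_fg.mp hN)
  choose d hd using exists_mem_boxFiltration (k := k) (n := n) he
  exact ⟨s.sup d, Submodule.span_le.mpr fun x hx => boxFiltration_mono (Finset.le_sup hx) (hd x)⟩

end BoxFiltration

/-! ### Torsion and degree shifts in `A𝒱`-modules. -/

section Modules
open MvPolynomial
variable {k : Type*} [Field k] {n : ℕ} {M : Type*} [AddCommGroup M]
  [Module (Poly k n) M] [Module (AVAlg k n) M] [IsScalarTower (Poly k n) (AVAlg k n) M]

theorem vf_smul_smul (η : VectorField k n) (f : Poly k n) (m : M) :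
    (vf η : AVAlg k n) • (f • m) = η f • m + f • ((vf η : AVAlg k n) • m) := by
  rw [← smul_one_smul (AVAlg k n) f m, ← mul_smul, vf_mul_smul, add_smul, mul_one, smul_assoc,
    smul_assoc, one_smul]

/-- A nonzero `A𝒱`-module that is finitely generated over `A` has an element with zero
annihilator. -/
theorem exists_smul_injective [CharZero k] [Module.Finite (Poly k n) M] [Nontrivial M] :
    ∃ v : M, Function.Injective fun f : Poly k n => f • v := by
  have hann : Module.annihilator (Poly k n) M = ⊥ := by
    by_contra hne
    have htop : Module.annihilator (Poly k n) M = ⊤ := by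
      -- If `p` kills `M`, then in `∂ᵢ(p m) = ∂ᵢ(p) m + p (∂ᵢ m)` the left side and the last term
      -- vanish.
      refine eq_top_of_pderiv_mem (fun p hp i => ?_) hne
      rw [Module.mem_annihilator] at hp ⊢
      intro m
      have h := vf_smul_smul (pderiv i) p m
      rwa [hp, hp, smul_zero, add_zero, eq_comm] at h
    obtain ⟨m, hm⟩ := exists_ne (0 : M)
    have h1 : (1 : Poly k n) ∈ Module.annihilator (Poly k n) M := htop ▸ Submodule.mem_top
    exact hm (by rw [← one_smul (Poly k n) m, Module.mem_annihilator.mp h1 m])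
  obtain ⟨s, hs⟩ := Module.Finite.fg_top (R := Poly k n) (M := M)
  by_contra! hcon
  have hex : ∀ v : M, ∃ f : Poly k n, f ≠ 0 ∧ f • v = 0 := by
    intro v
    have h := hcon v
    rw [Function.Injective] at h
    push Not at h
    obtain ⟨a, b, hab, hne⟩ := h
    exact ⟨a - b, sub_ne_zero.mpr hne, by rw [sub_smul, sub_eq_zero]; exact hab⟩
  choose f hf0 hf using hex
  -- If each generator were killed by a nonzero polynomial, their product, nonzero in a domain,
  -- would kill `M`.
  have hmem : ∏ v ∈ s, f v ∈ Module.annihilator (Poly k n) M := by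
    rw [Module.mem_annihilator]
    intro m
    have hm : m ∈ Submodule.span (Poly k n) (s : Set M) := hs ▸ Submodule.mem_top
    induction hm using Submodule.span_induction with
    | mem x hx =>
      obtain ⟨c, hc⟩ := Finset.dvd_prod_of_mem f hx
      rw [hc, mul_comm, mul_smul, hf, smul_zero]
    | zero => rw [smul_zero]
    | add x y _ _ hx hy => rw [smul_add, hx, hy, add_zero]
    | smul a x _ hx => rw [smul_comm, hx, smul_zero]
  rw [hann] at hmem
  exact Finset.prod_ne_zero_iff.mpr (fun v _ => hf0 v) hmem

variable [Module k M] [IsScalarTower k (AVAlg k n) M]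

variable (k n M) in
theorem isScalarTower_poly : IsScalarTower k (Poly k n) M :=
  ⟨fun c f m => by
    rw [← smul_one_smul (AVAlg k n) (c • f) m, smul_assoc c f (1 : AVAlg k n),
      smul_assoc c (f • (1 : AVAlg k n)) m, smul_one_smul]⟩

variable [IsScalarTower k (Poly k n) M] {r : ℕ} {e : Fin r → M}

/-- Every element of `A # U(𝒱)` raises the degrees of a finitely generated module by a bounded
amount. -/
theorem exists_smul_mem_boxFiltration
    (he : Submodule.span (Poly k n) (Set.range e) = ⊤) (s : AVAlg k n) : ∃ D, ∀ d,
    ∀ x ∈ boxFiltration (k := k) (n := n) e d,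
      s • x ∈ boxFiltration (k := k) (n := n) e (d + D) := by
  -- Elements with a bounded shift form a subalgebra, so only polynomials and vector fields need
  -- checking.
  let T : Subalgebra k (AVAlg k n) :=
    { carrier := {s | ∃ D, ∀ d, ∀ x ∈ boxFiltration (k := k) (n := n) e d,
        s • x ∈ boxFiltration (k := k) (n := n) e (d + D)}
      mul_mem' := by
        rintro a b ⟨D, hD⟩ ⟨E, hE⟩
        refine ⟨E + D, fun d x hx => ?_⟩
        rw [mul_smul, ← add_assoc]
        exact hD _ _ (hE _ _ hx)
      add_mem' := by
        rintro a b ⟨D, hD⟩ ⟨E, hE⟩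
        refine ⟨D + E, fun d x hx => ?_⟩
        rw [add_smul]
        exact Submodule.add_mem _ (boxFiltration_mono (by omega) (hD d x hx))
          (boxFiltration_mono (by omega) (hE d x hx))
      algebraMap_mem' := fun c => by
        refine ⟨0, fun d x hx => ?_⟩
        rw [algebraMap_smul]
        exact Submodule.smul_mem _ c hx }
  have hT : T = ⊤ := by
    refine Smash.subalgebra_eq_top T (fun f => ?_) (fun η => ?_)
    · refine ⟨f.totalDegree, fun d x hx => ?_⟩
      rw [smul_one_smul, add_comm]
      exact smul_mem_boxFiltration (mem_restrictDegree_totalDegree f) hx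
    · obtain ⟨D, hD⟩ := exists_vectorField_mem_restrictDegree η
      choose E hE using fun j => exists_mem_boxFiltration (k := k) (n := n) he
        ((vf η : AVAlg k n) • e j)
      -- In the Leibniz rule, `D` bounds the shift on the coefficients and `E j` the degree of `η
      -- eⱼ`.
      refine ⟨D + Finset.univ.sup E, fun d x hx => ?_⟩
      obtain ⟨p, hp, rfl⟩ := mem_boxFiltration.mp hx
      simp only [Finset.smul_sum, vf_smul_smul, Finset.sum_add_distrib]
      refine Submodule.add_mem _ ?_ (Submodule.sum_mem _ fun j hj => ?_)
      · exact mem_boxFiltration.mpr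
          ⟨fun j => η (p j), fun j => restrictDegree_mono (by omega) (hD d _ (hp j)), rfl⟩
      · have hj := Finset.le_sup (f := E) hj
        exact boxFiltration_mono (by omega) (smul_mem_boxFiltration (hp j) (hE j))
  exact (hT ▸ Algebra.mem_top : s ∈ T)

theorem exists_smul_le_boxFiltration
    (he : Submodule.span (Poly k n) (Set.range e) = ⊤) {C : Submodule k (AVAlg k n)} (hC : FiniteDimensional k C) :
    ∃ D, ∀ d, C • boxFiltration (k := k) (n := n) e d ≤
      boxFiltration (k := k) (n := n) e (d + D) := by
  obtain ⟨s, rfl⟩ := (Module.Finite.iff_fg.mp hC)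
  choose D hD using exists_smul_mem_boxFiltration (k := k) (n := n) he
  refine ⟨s.sup D, fun d => Submodule.smul_le.mpr fun a ha x hx => ?_⟩
  induction ha using Submodule.span_induction with
  | mem a ha =>
    have := Finset.le_sup (f := D) ha
    exact boxFiltration_mono (by omega) (hD a d x hx)
  | zero => rw [zero_smul]; exact Submodule.zero_mem _
  | add a b _ _ ha hb => rw [add_smul]; exact Submodule.add_mem _ ha hb
  | smul c a _ ha => rw [smul_assoc]; exact Submodule.smul_mem _ c ha

theorem exists_pow_smul_le_boxFiltration
    (he : Submodule.span (Poly k n) (Set.range e) = ⊤) {C : Submodule k (AVAlg k n)} {M₀ : Submodule k M}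
    (hC : FiniteDimensional k C) (hM₀ : FiniteDimensional k M₀) :
    ∃ d D, ∀ m : ℕ, C ^ m • M₀ ≤ boxFiltration (k := k) (n := n) e (d + m * D) := by
  obtain ⟨d, hd⟩ := exists_le_boxFiltration (n := n) he hM₀
  obtain ⟨D, hD⟩ := exists_smul_le_boxFiltration he hC
  refine ⟨d, D, fun m => ?_⟩
  induction m with
  | zero => rwa [pow_zero, Submodule.one_smul, Nat.zero_mul]
  | succ m ih =>
    rw [pow_succ', ← smul_eq_mul, Submodule.smul_assoc]
    refine (Submodule.smul_mono le_rfl ih).trans ((hD _).trans (boxFiltration_mono ?_))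
    rw [Nat.succ_mul, add_assoc]

end Modules

/-! ### Growth exponents from polynomial bounds. -/

section GrowthBounds
open Filter Topology

/-- A sequence squeezed between two polynomial bounds of degree `n` has growth exponent `n`. -/
theorem tendsto_logb_of_polynomial_bounds {f : ℕ → ℕ} {n : ℕ} (a b : ℝ) (ha : 0 < a) (hb : 0 < b)
    (hlow : ∀ᶠ m : ℕ in atTop, a * (m : ℝ) ^ n ≤ f m)
    (hup : ∀ᶠ m : ℕ in atTop, (f m : ℝ) ≤ b * (m : ℝ) ^ n) :
    Tendsto (fun m : ℕ => Real.logb m (f m)) atTop (𝓝 n) := by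
  have hlim : ∀ c : ℝ, Tendsto (fun m : ℕ => Real.logb m c + n) atTop (𝓝 n) := by
    intro c
    have h : Tendsto (fun m : ℕ => Real.log c / Real.log m) atTop (𝓝 0) :=
      (Real.tendsto_log_atTop.comp tendsto_natCast_atTop_atTop).const_div_atTop _
    simpa [Real.logb] using h.add_const (n : ℝ)
  have hlog : ∀ c : ℝ, 0 < c → ∀ m : ℕ, 2 ≤ m →
      Real.logb m (c * (m : ℝ) ^ n) = Real.logb m c + n := by
    intro c hc m hm
    have h1 : (1 : ℝ) < m := by exact_mod_cast hm
    rw [Real.logb_mul hc.ne' (by positivity), Real.logb_pow, Real.logb_self_eq_one h1, mul_one]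
  refine tendsto_of_tendsto_of_tendsto_of_le_of_le' (hlim a) (hlim b) ?_ ?_
  · filter_upwards [hlow, eventually_ge_atTop 2] with m h hm
    have h1 : (1 : ℝ) < m := by exact_mod_cast hm
    rw [← hlog a ha m hm]
    exact Real.logb_le_logb_of_le h1 (by positivity) h
  -- The lower bound is needed here too: it makes `f m` positive, so that the logarithm is monotone.
  · filter_upwards [hlow, hup, eventually_ge_atTop 2] with m h' h hm
    have h1 : (1 : ℝ) < m := by exact_mod_cast hm
    rw [← hlog b hb m hm]
    exact Real.logb_le_logb_of_le h1 (lt_of_lt_of_le (by positivity) h') h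

/-- Take `c = ⌊(m - q) / (P + 1)⌋`. For `m ≥ 2q` one has `m ≤ 2(m - q) ≤ 2(P + 1)(c + 1)`, which
gives the lower constant. For `m ≥ 1`, `d + m D + 1 ≤ (d + D + 1) m` gives the upper one. Using `P +
1` and `r + 1` covers `P = 0` and `r = 0`. -/
theorem tendsto_logb_of_box_bounds {f : ℕ → ℕ} {n r d D P q : ℕ}
    (hup : ∀ m, f m ≤ r * (d + m * D + 1) ^ n)
    (hlow : ∀ c m, P * c + q ≤ m → (c + 1) ^ n ≤ f m) :
    Tendsto (fun m : ℕ => Real.logb m (f m)) atTop (𝓝 n) := by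
  refine tendsto_logb_of_polynomial_bounds ((1 / (2 * (P + 1))) ^ n)
    ((r + 1) * (d + D + 1) ^ n) (by positivity) (by positivity) ?_ ?_
  · filter_upwards [eventually_ge_atTop (2 * q)] with m hm
    obtain ⟨c, t, ht, hct⟩ : ∃ c t, t < P + 1 ∧ P * c + c + t = m - q :=
      ⟨(m - q) / (P + 1), (m - q) % (P + 1), Nat.mod_lt _ P.succ_pos, by
        rw [← Nat.succ_mul]; exact Nat.div_add_mod _ _⟩
    have h1 : (c + 1) ^ n ≤ f m := hlow c m (by omega)
    have h2 : m ≤ 2 * (P + 1) * (c + 1) := by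
      have : 2 * (P + 1) * (c + 1) = 2 * (P * c + c + P + 1) := by ring
      omega
    have h2' : (m : ℝ) ≤ 2 * (P + 1) * (c + 1) := by exact_mod_cast h2
    have h1' : ((c : ℝ) + 1) ^ n ≤ f m := by exact_mod_cast h1
    refine le_trans ?_ h1'
    rw [← mul_pow]
    refine pow_le_pow_left₀ (by positivity) ?_ n
    rw [one_div, inv_mul_le_iff₀ (by positivity)]
    exact h2'
  · filter_upwards [eventually_ge_atTop 1] with m hm
    have h1 : f m ≤ (r + 1) * (d + D + 1) ^ n * m ^ n := by
      refine (hup m).trans ?_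
      rw [mul_assoc, ← mul_pow]
      refine Nat.mul_le_mul (Nat.le_succ r) (Nat.pow_le_pow_left ?_ n)
      nlinarith [Nat.zero_le d, Nat.zero_le D]
    exact_mod_cast h1

end GrowthBounds

/-! ### Exhaustion by the powers of a generating subspace. -/

section GeneratingSubspaces
variable {k : Type*} [Field k] {R : Type*} [Ring R] [Algebra k R]
  {M : Type*} [AddCommGroup M] [Module k M] [Module R M] [IsScalarTower k R M]

theorem pow_mono_of_one_mem {C : Submodule k R} (h1 : (1 : R) ∈ C) {i j : ℕ} (h : i ≤ j) :
    C ^ i ≤ C ^ j := by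
  obtain ⟨l, rfl⟩ := exists_add_of_le h
  intro x hx
  rw [pow_add, ← mul_one x]
  refine Submodule.mul_mem_mul hx ?_
  have := Submodule.pow_mem_pow C h1 l
  rwa [one_pow] at this

/-- Since `1 ∈ C`, the powers increase, so their union is a subalgebra containing `C`. -/
theorem IsGeneratingSubspace.exists_mem_pow {C : Submodule k R} (hC : IsGeneratingSubspace k R C)
    (x : R) : ∃ i, x ∈ C ^ i := by
  let T : Subalgebra k R :=
    { carrier := {x | ∃ i, x ∈ C ^ i}
      mul_mem' := by
        rintro a b ⟨i, hi⟩ ⟨j, hj⟩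
        exact ⟨i + j, by rw [pow_add]; exact Submodule.mul_mem_mul hi hj⟩
      add_mem' := by
        rintro a b ⟨i, hi⟩ ⟨j, hj⟩
        exact ⟨max i j, Submodule.add_mem _ (pow_mono_of_one_mem hC.one_mem (le_max_left i j) hi)
          (pow_mono_of_one_mem hC.one_mem (le_max_right i j) hj)⟩
      algebraMap_mem' := fun c => ⟨0, by rw [pow_zero]; exact Submodule.algebraMap_mem c⟩ }
  have hT : Algebra.adjoin k (C : Set R) ≤ T :=
    Algebra.adjoin_le fun x hx => ⟨1, by rwa [pow_one]⟩
  exact hT (hC.adjoin_eq_top ▸ Algebra.mem_top)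

theorem exists_mem_pow_smul {C : Submodule k R} (hC : IsGeneratingSubspace k R C)
    {M₀ : Submodule k M} (hM₀ : IsGeneratingSubspaceOfModule k R M M₀) (x : M) :
    ∃ q, x ∈ C ^ q • M₀ := by
  have hx : x ∈ Submodule.span R (M₀ : Set M) := hM₀.span_eq_top ▸ Submodule.mem_top
  induction hx using Submodule.span_induction with
  | mem x hx => exact ⟨0, by rwa [pow_zero, Submodule.one_smul]⟩
  | zero => exact ⟨0, Submodule.zero_mem _⟩
  | add x y _ _ hx hy =>
    obtain ⟨i, hi⟩ := hx
    obtain ⟨j, hj⟩ := hy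
    exact ⟨max i j, Submodule.add_mem _
      (Submodule.smul_mono_left (pow_mono_of_one_mem hC.one_mem (le_max_left i j)) hi)
      (Submodule.smul_mono_left (pow_mono_of_one_mem hC.one_mem (le_max_right i j)) hj)⟩
  | smul a x _ hx =>
    obtain ⟨i, hi⟩ := hx
    obtain ⟨j, hj⟩ := hC.exists_mem_pow a
    refine ⟨j + i, ?_⟩
    rw [pow_add, ← smul_eq_mul, Submodule.smul_assoc]
    exact Submodule.smul_mem_smul hj hi

end GeneratingSubspaces

/-! ### The growth exponent of a module finitely generated over `A`. -/

section Holonomic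
open MvPolynomial
variable {k : Type*} [Field k] {n : ℕ}

theorem xpow_smul_one_mem_pow {C : Submodule k (AVAlg k n)} {p : ℕ}
    (hX : ∀ i : Fin n, (X i : Poly k n) • (1 : AVAlg k n) ∈ C ^ p) (m : Fin n →₀ ℕ) :
    xpow k m • (1 : AVAlg k n) ∈ C ^ (p * m.degree) := by
  induction hd : m.degree generalizing m with
  | zero =>
    rw [(Finsupp.degree_eq_zero_iff m).mp hd, xpow, monomial_zero', C_1, one_smul, mul_zero,
      pow_zero]
    exact Submodule.one_le.mp le_rfl
  | succ d ih =>
    have hm0 : m ≠ 0 := by rintro rfl; simp at hd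
    obtain ⟨i, hi⟩ := Finsupp.ne_iff.mp hm0
    obtain ⟨b, rfl⟩ := exists_add_of_le
      (Finsupp.single_le_iff.mpr (Nat.one_le_iff_ne_zero.mpr hi))
    have hb : b.degree = d := by simp at hd; omega
    have h : xpow k (Finsupp.single i 1 + b) = X i * xpow k b := by
      rw [xpow, xpow, X, monomial_mul, one_mul]
    rw [h, mul_smul, ← Smash.smul_one_mul, mul_add, mul_one, add_comm, pow_add]
    exact Submodule.mul_mem_mul (hX i) (ih b hb)

/-- A monomial of degree at most `d` in each of `n` variables has total degree at most `n d`, and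
each variable costs `p` factors from `C`. -/
theorem smul_one_mem_pow_of_mem_restrictDegree {C : Submodule k (AVAlg k n)} {p : ℕ}
    (h1 : (1 : AVAlg k n) ∈ C)
    (hX : ∀ i : Fin n, (X i : Poly k n) • (1 : AVAlg k n) ∈ C ^ p) {d : ℕ} {f : Poly k n}
    (hf : f ∈ restrictDegree (Fin n) k d) : f • (1 : AVAlg k n) ∈ C ^ (p * n * d) := by
  rw [f.as_sum, Finset.sum_smul]
  refine Submodule.sum_mem _ fun m hm => ?_
  have h : monomial m (coeff m f) = coeff m f • xpow k m := by
    rw [xpow, smul_monomial, smul_eq_mul, mul_one]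
  rw [h, smul_assoc]
  refine Submodule.smul_mem _ _ (pow_mono_of_one_mem h1 ?_ (xpow_smul_one_mem_pow hX m))
  rw [mul_assoc]
  refine Nat.mul_le_mul_left p ?_
  rw [Finsupp.degree_eq_sum]
  refine (Finset.sum_le_card_nsmul _ _ d fun i _ => (mem_restrictDegree _ _ _).mp hf m hm i).trans ?_
  simp

variable {M : Type*} [AddCommGroup M] [Module k M]
  [Module (Poly k n) M] [Module (AVAlg k n) M] [IsScalarTower k (AVAlg k n) M]
  [IsScalarTower (Poly k n) (AVAlg k n) M]

theorem restrictDegree_smul_mem {C : Submodule k (AVAlg k n)} {M₀ : Submodule k M} {p q : ℕ}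
    (h1 : (1 : AVAlg k n) ∈ C)
    (hX : ∀ i : Fin n, (X i : Poly k n) • (1 : AVAlg k n) ∈ C ^ p) {v : M}
    (hv : v ∈ C ^ q • M₀) {c m : ℕ} (hm : p * n * c + q ≤ m) {f : Poly k n}
    (hf : f ∈ restrictDegree (Fin n) k c) : f • v ∈ C ^ m • M₀ := by
  refine Submodule.smul_mono_left (pow_mono_of_one_mem h1 hm) ?_
  rw [← smul_one_smul (AVAlg k n) f v, pow_add, ← smul_eq_mul, Submodule.smul_assoc]
  exact Submodule.smul_mem_smul (smul_one_mem_pow_of_mem_restrictDegree h1 hX hf) hv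

theorem growth_eq_of_finite [CharZero k] [Module.Finite (Poly k n) M] [Nontrivial M]
    {C : Submodule k (AVAlg k n)} {M₀ : Submodule k M}
    (hC : IsGeneratingSubspace k (AVAlg k n) C)
    (hM₀ : IsGeneratingSubspaceOfModule k (AVAlg k n) M M₀) :
    growth C M₀ = ((n : ℝ) : EReal) := by
  have := isScalarTower_poly k n M
  obtain ⟨r, e, he⟩ := Module.Finite.exists_fin (R := Poly k n) (M := M)
  obtain ⟨d, D, hd⟩ :=
    exists_pow_smul_le_boxFiltration he hC.finiteDimensional hM₀.finiteDimensional
  obtain ⟨v, hv⟩ := exists_smul_injective (k := k) (n := n) (M := M)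
  obtain ⟨q, hq⟩ := exists_mem_pow_smul hC hM₀ v
  choose p hp using fun i : Fin n => hC.exists_mem_pow ((X i : Poly k n) • (1 : AVAlg k n))
  have hX : ∀ i : Fin n, (X i : Poly k n) • (1 : AVAlg k n) ∈ C ^ (Finset.univ.sup p) :=
    fun i => pow_mono_of_one_mem hC.one_mem (Finset.le_sup (Finset.mem_univ i)) (hp i)
  refine Filter.Tendsto.limsup_eq ((continuous_coe_real_ereal.tendsto _).comp
    (tendsto_logb_of_box_bounds (r := r) (d := d) (D := D) (P := Finset.univ.sup p * n) (q := q)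
      (fun m => ?_) (fun c m hm => ?_)))
  · exact (Submodule.finrank_mono (hd m)).trans (finrank_boxFiltration_le _)
  · have : FiniteDimensional k (C ^ m • M₀ : Submodule k M) :=
      Submodule.finiteDimensional_of_le (hd m)
    -- The map `f ↦ f v` on the box of side `c`; it is injective by the choice of `v`.
    let φ : restrictDegree (Fin n) k c →ₗ[k] (C ^ m • M₀ : Submodule k M) :=
      LinearMap.codRestrict _
        (((LinearMap.toSpanSingleton (Poly k n) M v).restrictScalars k).comp
          (restrictDegree (Fin n) k c).subtype)
        fun f => restrictDegree_smul_mem hC.one_mem hX hq hm f.2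
    have hφ : Function.Injective φ := fun f g h => Subtype.ext (hv (congrArg Subtype.val h))
    rw [← finrank_restrictDegree (k := k) (n := n) c]
    exact LinearMap.finrank_le_finrank_of_injective hφ

theorem isHolonomic_of_finite [CharZero k] [Module.Finite (Poly k n) M] : IsHolonomic k n M := by
  have hfin : Module.Finite (AVAlg k n) M :=
    Module.Finite.of_restrictScalars_finite (Poly k n) (AVAlg k n) M
  refine ⟨hfin, ?_⟩
  rcases subsingleton_or_nontrivial M with h | h
  · exact Or.inl h
  · exact Or.inr ⟨inferInstance, hfin, fun C M₀ hC hM₀ => growth_eq_of_finite hC hM₀⟩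

end Holonomic

/-- The trivialization carries finiteness over from `A ⊗ kʳ`. -/
theorem IsGaugeModule.finite {k : Type*} [Field k] {n : ℕ} {M : Type*} [AddCommGroup M]
    [Module (Poly k n) M] [Module (AVAlg k n) M] (h : IsGaugeModule k n M) :
    Module.Finite (Poly k n) M := by
  obtain ⟨r, ⟨g⟩⟩ := h
  exact Module.Finite.equiv g.e

end AV

end

theorem mainTheorem8 {k : Type*} [Field k] [IsAlgClosed k] [CharZero k] (n : ℕ)
    {M : Type*} [AddCommGroup M] [Module k M] [Module (AV.Poly k n) M]
    [Module (AV.AVAlg k n) M] [IsScalarTower k (AV.AVAlg k n) M]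
    [IsScalarTower (AV.Poly k n) (AV.AVAlg k n) M] :
    (Module.Finite (AV.Poly k n) M → AV.IsHolonomic k n M) ∧
    (AV.IsGaugeModule k n M → Module.Finite (AV.Poly k n) M ∧ AV.IsHolonomic k n M) := by
  refine ⟨fun _ => AV.isHolonomic_of_finite, fun h => ?_⟩
  have := h.finite
  exact ⟨this, AV.isHolonomic_of_finite⟩
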